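/- **Theorem (Uniform sampling).** Let $X\in\mathbb{R}^{n\times d}$ ($d\ge 1$) have full column rank, let $y\in\mathbb{R}^n$, and let $X=U\Sigma V^T$ be a thin singular value decomposition ($U\in\mathbb{R}^{n\times d}$, $V\in\mathbb{R}^{d\times d}$, $U^TU=V^TV=I_d$), with largest and smallest singular values $\sigma_{\max}(X)\ge\sigma_{\min}(X)>0$, and let $\kappa(X)=\sigma_{\max}(X)/\sigma_{\min}(X)$. Let $\mu=\frac{n}{d}\max_{1\le i\le n}\|u^{(i)}\|_2^2$ be the row coherence of $X$, where $u^{(i)}$ is the $i$-th row of $U$. Let $\beta_{LSR}=\arg\min_\beta\|y-X\beta\|_2^2$. Let $c\le n$ be an integer with $$c\ \ge\ 1000\,\mu\,d\,(\ln d+7),$$ let $S\in\mathbb{R}^{c\times n}$ consist of $c$ rows of the identity matrix $I_n$ drawn uniformly at random without replacement, and let $\tilde\beta_S$ be a minimizer of $\|Sy-SX\beta\|_2^2$ over $\beta\in\mathbb{R}^d$. Then with probability at least $0.05$ the inequalities $$\|y-X\tilde\beta_S\|_2^2\ \le\ 2.2\,\|y-X\beta_{LSR}\|_2^2,\qquad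 \|\beta_{LSR}-\tilde\beta_S\|_2^2\ \le\ \frac{1.2}{\sigma_{\min}^2(X)}\,\|y-X\beta_{LSR}\|_2^2$$ both hold, for every such minimizer $\tilde\beta_S$. Moreover, for every $\gamma>0$ with $\gamma\|y\|_2\le\|UU^Ty\|_2$, $$\frac{1.2}{\sigma_{\min}^2(X)}\,\|y-X\beta_{LSR}\|_2^2\ \le\ 1.2\,\kappa^2(X)\,(\gamma^{-2}-1)\,\|\beta_{LSR}\|_2^2 .$$ -/

import Mathlib

open scoped Matrix

noncomputable section

/-- The Euclidean norm of a real vector. -/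
def l2norm {ι : Type*} [Fintype ι] (v : ι → ℝ) : ℝ :=
  ‖WithLp.toLp 2 v‖

/-- `X = U diag(σ) Vᵀ` is a thin singular value decomposition of the `n × d` matrix `X`:
`U` is `n × d` with orthonormal columns, `V` is `d × d` orthogonal, and the singular values
are nonnegative and in non-increasing order. -/
structure IsThinSVD {n d : ℕ} (X : Matrix (Fin n) (Fin d) ℝ) (U : Matrix (Fin n) (Fin d) ℝ)
    (σ : Fin d → ℝ) (V : Matrix (Fin d) (Fin d) ℝ) : Prop where
  orthonormal_left : Uᵀ * U = 1
  orthogonal_right : Vᵀ * V = 1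
  nonneg : ∀ i, 0 ≤ σ i
  antitone : Antitone σ
  eq_mul : X = U * Matrix.diagonal σ * Vᵀ

/-- The largest of `d ≥ 1` singular values listed in non-increasing order. -/
def sigmaMax {d : ℕ} (hd : 0 < d) (σ : Fin d → ℝ) : ℝ := σ ⟨0, hd⟩

/-- The smallest of `d ≥ 1` singular values listed in non-increasing order. -/
def sigmaMin {d : ℕ} (hd : 0 < d) (σ : Fin d → ℝ) : ℝ := σ ⟨d - 1, Nat.sub_lt hd Nat.one_pos⟩

/-- The condition number `σ_max / σ_min`. -/
def conditionNumber {d : ℕ} (hd : 0 < d) (σ : Fin d → ℝ) : ℝ := sigmaMax hd σ / sigmaMin hd σ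

/-- The `i`-th row leverage score: the squared norm of the `i`-th row of the left singular
factor `U`. -/
def leverageScore {n d : ℕ} (U : Matrix (Fin n) (Fin d) ℝ) (i : Fin n) : ℝ :=
  l2norm (fun j => U i j) ^ 2

/-- The row coherence `μ = (n / d) max_i l_i`. -/
def rowCoherence {n d : ℕ} (U : Matrix (Fin n) (Fin d) ℝ) : ℝ :=
  ((n : ℝ) / (d : ℝ)) * ⨆ i, leverageScore U i

/-- `β` minimizes `‖b - A β‖₂²`. -/
def IsLeastSquaresSolution {m d : ℕ} (A : Matrix (Fin m) (Fin d) ℝ) (b : Fin m → ℝ)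
    (β : Fin d → ℝ) : Prop :=
  ∀ β' : Fin d → ℝ, l2norm (b - A *ᵥ β) ^ 2 ≤ l2norm (b - A *ᵥ β') ^ 2

/-- The `c × n` sampling matrix whose `k`-th row is row `e k` of the `n × n` identity matrix. -/
def samplingMatrix {n c : ℕ} (e : Fin c ↪ Fin n) : Matrix (Fin c) (Fin n) ℝ :=
  (1 : Matrix (Fin n) (Fin n) ℝ).submatrix e id

/-- The probability of the event `E` when `c` of `n` indices are drawn uniformly at random
without replacement, that is, when the list of the `c` distinct indices is uniformly distributed. -/
def samplingProb {n c : ℕ} (E : Set (Fin c ↪ Fin n)) : ℝ :=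
  (E.ncard : ℝ) / (Nat.card (Fin c ↪ Fin n) : ℝ)

end

/-! Let p = c/n, let M be the largest leverage score, r the least squares residual (orthogonal to
the columns of U), G the Gram matrix of the sampled rows uᵢ of U, and T = Σ rᵢ uᵢ over the sample.
If Uz = X(β_S − β), the sampled normal equations give zᵀGz = T·z. Hence G ≥ δI forces δ‖z‖ ≤ ‖T‖;
Pythagoras turns this into the residual bound and σ_min into the coefficient bound
(`IsThinSVD.sampled_solution_bounds`). Two events remain, with δ = p/40.

T is small: the full sum Σ rᵢ uᵢ vanishes, so sampling without replacement has mean square at most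
pM‖r‖², and Markov's inequality applies (`samplingProb_dotProduct_sum_self_gt_le`).

G is large: follow the potential tr (sI + G)⁻ᵠ, with q about ln d, draw by draw. A rank-one update
lowers it by a definite amount (`trace_pow_sub_trace_pow_ge`); averaging over the undrawn rows,
whose Gram matrix is I − G, gives an affine contraction in mean
(`sum_trace_inv_ridgeGram_insert_le`). Markov's inequality for the final potential bounds the least
eigenvalue below (`samplingProb_quadForm_rowGram_lt_le`). No matrix exponentials or independence are
needed.

The events fail with probability at most 1/20 and 1/5, so success has probability at least 3/4. -/

theorem pow_sub_pow_eq_sum_of_resolvent_identity {R : Type*} [Ring R] {P P' K : R}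
    (h : P - P' = P * K * P') (m : ℕ) :
    P ^ m - P' ^ m = ∑ i ∈ Finset.range m, P ^ (i + 1) * K * P' ^ (m - i) := by
  induction m with
  | zero => simp
  | succ m ih =>
    have key : P ^ (m + 1) - P' ^ (m + 1) = P * (P ^ m - P' ^ m) + (P - P') * P' ^ m := by
      rw [pow_succ' P, pow_succ' P']; noncomm_ring
    rw [key, ih, h, Finset.sum_range_succ', Finset.mul_sum]
    congr 1
    · refine Finset.sum_congr rfl fun i _ => ?_
      rw [pow_succ' P (i + 1), Nat.add_sub_add_right]
      simp only [mul_assoc]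
    · simp only [zero_add, pow_one, Nat.sub_zero, pow_succ' P' m, mul_assoc]

/-! ### Rank-one updates and traces of resolvent powers. -/

section RankOne

variable {ι : Type*} [Fintype ι]

theorem quadForm_mul_vecMulVec_mul (A B : Matrix ι ι ℝ) (u : ι → ℝ) :
    u ⬝ᵥ ((A * Matrix.vecMulVec u u * B) *ᵥ u) = (u ⬝ᵥ (A *ᵥ u)) * (u ⬝ᵥ (B *ᵥ u)) := by
  rw [mul_assoc, ← Matrix.mulVec_mulVec, ← Matrix.mulVec_mulVec, Matrix.vecMulVec_mulVec]
  simp [Matrix.mulVec_smul, mul_comm]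

theorem trace_mul_vecMulVec_mul (A B : Matrix ι ι ℝ) (u : ι → ℝ) :
    (A * Matrix.vecMulVec u u * B).trace = u ⬝ᵥ ((B * A) *ᵥ u) := by
  rw [Matrix.trace_mul_comm, ← mul_assoc, Matrix.mul_vecMulVec, Matrix.trace_vecMulVec,
    dotProduct_comm]

/-- Chebyshev's sum inequality for the weights `w i * x i`: the powers `x ^ a` and `x ^ b` are
similarly ordered, so the symmetrized double sum is nonnegative. -/
theorem weighted_chebyshev {w x : ι → ℝ} (hw : ∀ i, 0 ≤ w i) (hx : ∀ i, 0 ≤ x i) (a b : ℕ) :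
    (∑ i, w i * x i ^ (a + 1)) * (∑ i, w i * x i ^ (b + 1)) ≤
      (∑ i, w i * x i ^ 1) * ∑ i, w i * x i ^ (a + b + 1) := by
  have key : 0 ≤ ∑ i, ∑ j, w i * w j * (x i * x j) *
      ((x i ^ a - x j ^ a) * (x i ^ b - x j ^ b)) := by
    refine Finset.sum_nonneg fun i _ => Finset.sum_nonneg fun j _ =>
      mul_nonneg (mul_nonneg (mul_nonneg (hw i) (hw j)) (mul_nonneg (hx i) (hx j))) ?_
    rcases le_total (x i) (x j) with h | h
    · exact mul_nonneg_of_nonpos_of_nonpos (sub_nonpos.2 (pow_le_pow_left₀ (hx i) h a))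
        (sub_nonpos.2 (pow_le_pow_left₀ (hx i) h b))
    · exact mul_nonneg (sub_nonneg.2 (pow_le_pow_left₀ (hx j) h a))
        (sub_nonneg.2 (pow_le_pow_left₀ (hx j) h b))
  have expand : ∑ i, ∑ j, w i * w j * (x i * x j) *
      ((x i ^ a - x j ^ a) * (x i ^ b - x j ^ b)) =
      (∑ i, w i * x i ^ (a + b + 1)) * (∑ j, w j * x j ^ 1)
      + (∑ i, w i * x i ^ 1) * (∑ j, w j * x j ^ (a + b + 1))
      - (∑ i, w i * x i ^ (a + 1)) * (∑ j, w j * x j ^ (b + 1))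
      - (∑ i, w i * x i ^ (b + 1)) * (∑ j, w j * x j ^ (a + 1)) := by
    simp only [Finset.sum_mul_sum, ← Finset.sum_add_distrib, ← Finset.sum_sub_distrib]
    refine Finset.sum_congr rfl fun i _ => Finset.sum_congr rfl fun j _ => ?_
    ring
  rw [expand] at key
  linarith [mul_comm (∑ i, w i * x i ^ (a + b + 1)) (∑ j, w j * x j ^ 1),
    mul_comm (∑ i, w i * x i ^ (b + 1)) (∑ j, w j * x j ^ (a + 1))]

variable [DecidableEq ι]

theorem exists_spectral_decomposition {A : Matrix ι ι ℝ} (hA : A.PosSemidef) :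
    ∃ (Q : Matrix ι ι ℝ) (x : ι → ℝ), Q * Qᵀ = 1 ∧ Qᵀ * Q = 1 ∧ (∀ i, 0 ≤ x i) ∧
      A = Q * Matrix.diagonal x * Qᵀ := by
  have h := hA.isHermitian.spectral_theorem
  refine ⟨hA.isHermitian.eigenvectorUnitary, hA.isHermitian.eigenvalues, ?_, ?_,
    hA.eigenvalues_nonneg, ?_⟩
  · have := Unitary.coe_mul_star_self hA.isHermitian.eigenvectorUnitary
    simpa [Matrix.star_eq_conjTranspose] using this
  · have := Unitary.coe_star_mul_self hA.isHermitian.eigenvectorUnitary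
    simpa [Matrix.star_eq_conjTranspose] using this
  · conv_lhs => rw [h]
    rw [Unitary.conjStarAlgAut_apply]
    rfl

theorem conj_diagonal_pow {Q : Matrix ι ι ℝ} (hQ : Q * Qᵀ = 1) (hQ' : Qᵀ * Q = 1) (x : ι → ℝ)
    (m : ℕ) :
    (Q * Matrix.diagonal x * Qᵀ) ^ m = Q * Matrix.diagonal (fun i => x i ^ m) * Qᵀ := by
  induction m with
  | zero => simp [hQ]
  | succ m ih =>
    rw [pow_succ, ih]
    calc Q * Matrix.diagonal (fun i => x i ^ m) * Qᵀ * (Q * Matrix.diagonal x * Qᵀ)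
        = Q * Matrix.diagonal (fun i => x i ^ m) * (Qᵀ * Q) * Matrix.diagonal x * Qᵀ := by
          simp only [mul_assoc]
      _ = _ := by
          rw [hQ', mul_one, mul_assoc Q, Matrix.diagonal_mul_diagonal]; simp only [pow_succ]

theorem quadForm_conj_diagonal (Q : Matrix ι ι ℝ) (x u : ι → ℝ) :
    u ⬝ᵥ ((Q * Matrix.diagonal x * Qᵀ) *ᵥ u) = ∑ i, (Qᵀ *ᵥ u) i ^ 2 * x i := by
  rw [← Matrix.mulVec_mulVec, ← Matrix.mulVec_mulVec, Matrix.dotProduct_mulVec,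
    ← Matrix.mulVec_transpose, dotProduct]
  refine Finset.sum_congr rfl fun i _ => ?_
  rw [Matrix.mulVec_diagonal]; ring

theorem quadForm_pow_mul_le {P : Matrix ι ι ℝ} (hP : P.PosSemidef) (u : ι → ℝ) (a b : ℕ) :
    (u ⬝ᵥ (P ^ (a + 1) *ᵥ u)) * (u ⬝ᵥ (P ^ (b + 1) *ᵥ u)) ≤
      (u ⬝ᵥ (P *ᵥ u)) * (u ⬝ᵥ (P ^ (a + b + 1) *ᵥ u)) := by
  obtain ⟨Q, x, hQ, hQ', hx, rfl⟩ := exists_spectral_decomposition hP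
  have := weighted_chebyshev (w := fun i => (Qᵀ *ᵥ u) i ^ 2) (fun i => sq_nonneg _) hx a b
  simp only [conj_diagonal_pow hQ hQ', quadForm_conj_diagonal]
  simpa only [pow_one] using this

theorem quadForm_pow_nonneg {P : Matrix ι ι ℝ} (hP : P.PosSemidef) (u : ι → ℝ) (a : ℕ) :
    0 ≤ u ⬝ᵥ (P ^ a *ᵥ u) := by
  simpa using (hP.pow a).dotProduct_mulVec_nonneg u

/-- A rank-one update lowers the trace of the `q`-th power of the resolvent by a definite amount. -/
theorem trace_pow_sub_trace_pow_ge {P P' : Matrix ι ι ℝ} (hP : P.PosSemidef) (hP' : P'.PosSemidef)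
    {u : ι → ℝ} (h : P - P' = P * Matrix.vecMulVec u u * P')
    (h' : P - P' = P' * Matrix.vecMulVec u u * P) (q : ℕ) :
    q * (1 - q * (u ⬝ᵥ (P *ᵥ u))) * (u ⬝ᵥ (P ^ (q + 1) *ᵥ u)) ≤ (P ^ q).trace - (P' ^ q).trace := by
  set g : ℕ → ℝ := fun m => u ⬝ᵥ (P ^ m *ᵥ u) with hg
  set g' : ℕ → ℝ := fun m => u ⬝ᵥ (P' ^ m *ᵥ u) with hg'
  set g1 := u ⬝ᵥ (P *ᵥ u) with hg1
  have g0 : ∀ m, 0 ≤ g m := quadForm_pow_nonneg hP u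
  have g0' : ∀ m, 0 ≤ g' m := quadForm_pow_nonneg hP' u
  have cheb : ∀ a b, g (a + 1) * g (b + 1) ≤ g1 * g (a + b + 1) := quadForm_pow_mul_le hP u
  have hg10 : 0 ≤ g1 := by simpa [hg] using g0 1
  -- The telescoping identity with `P` and `P'` exchanged trades mixed products for quadratic forms
  -- in a single resolvent.
  have mixed : ∀ m j, u ⬝ᵥ ((P' ^ m * P ^ j) *ᵥ u) =
      g (m + j) - ∑ i ∈ Finset.range m, g' (i + 1) * g (m - i + j) := by
    intro m j
    have e : P' - P = P' * (-Matrix.vecMulVec u u) * P := by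
      rw [← neg_sub, h', mul_neg, neg_mul]
    have e1 : P' ^ m * P ^ j = P ^ (m + j) -
        ∑ i ∈ Finset.range m, P' ^ (i + 1) * Matrix.vecMulVec u u * P ^ (m - i + j) := by
      have := pow_sub_pow_eq_sum_of_resolvent_identity e m
      rw [sub_eq_iff_eq_add] at this
      rw [this, add_mul, ← pow_add, Finset.sum_mul, add_comm, sub_eq_add_neg,
        ← Finset.sum_neg_distrib]
      congr 1
      refine Finset.sum_congr rfl fun i _ => ?_
      rw [pow_add P (m - i) j]
      simp only [mul_neg, neg_mul, mul_assoc]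
    rw [e1, Matrix.sub_mulVec, dotProduct_sub, Matrix.sum_mulVec, dotProduct_sum]
    simp only [quadForm_mul_vecMulVec_mul, hg, hg']
  have hle : ∀ m, g' m ≤ g m := by
    intro m
    have := mixed m 0
    simp only [pow_zero, mul_one, add_zero] at this
    have h2 : 0 ≤ ∑ i ∈ Finset.range m, g' (i + 1) * g (m - i) :=
      Finset.sum_nonneg fun i _ => mul_nonneg (g0' _) (g0 _)
    change g' m = _ at this
    linarith
  -- Each of the `m` corrections is at most `g1 * g (m + j)`, by `g' ≤ g` and then Chebyshev.
  have mixed_ge : ∀ m j, g (m + j) * (1 - m * g1) ≤ u ⬝ᵥ ((P' ^ m * P ^ j) *ᵥ u) := by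
    intro m j
    rw [mixed]
    have : ∑ i ∈ Finset.range m, g' (i + 1) * g (m - i + j) ≤
        ∑ i ∈ Finset.range m, g1 * g (m + j) := by
      refine Finset.sum_le_sum fun i hi => ?_
      rw [Finset.mem_range] at hi
      obtain ⟨b, rfl⟩ := Nat.exists_eq_add_of_lt hi
      have e1 : i + b + 1 - i + j = (b + j) + 1 := by omega
      have e2 : i + b + 1 + j = i + (b + j) + 1 := by omega
      rw [e1, e2]
      exact (mul_le_mul_of_nonneg_right (hle _) (g0 _)).trans (cheb i (b + j))
    simp only [Finset.sum_const, Finset.card_range, nsmul_eq_mul] at this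
    linarith
  rw [← Matrix.trace_sub, pow_sub_pow_eq_sum_of_resolvent_identity h q, Matrix.trace_sum]
  simp only [trace_mul_vecMulVec_mul]
  have : ∑ i ∈ Finset.range q, (1 - q * g1) * g (q + 1) ≤
      ∑ i ∈ Finset.range q, u ⬝ᵥ ((P' ^ (q - i) * P ^ (i + 1)) *ᵥ u) := by
    refine Finset.sum_le_sum fun i hi => ?_
    rw [Finset.mem_range] at hi
    refine le_trans ?_ (mixed_ge (q - i) (i + 1))
    have e : q - i + (i + 1) = q + 1 := by omega
    rw [e, mul_comm]
    refine mul_le_mul_of_nonneg_left ?_ (g0 _)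
    have : ((q - i : ℕ) : ℝ) ≤ q := by exact_mod_cast Nat.sub_le q i
    nlinarith
  simp only [Finset.sum_const, Finset.card_range, nsmul_eq_mul] at this
  linarith

end RankOne

/-- The mean of a function of the set of the first `k` draws without replacement from `Fin n`. -/
noncomputable def samplingMean (n k : ℕ) (F : Finset (Fin n) → ℝ) : ℝ :=
  (∑ e : Fin k ↪ Fin n, F (Finset.univ.map e)) / (Fintype.card (Fin k ↪ Fin n) : ℝ)

/-! ### Means and probabilities under sampling without replacement. -/

section Sampling

variable {n k : ℕ}

theorem card_embedding_pos (hk : k ≤ n) : (0 : ℝ) < Fintype.card (Fin k ↪ Fin n) := by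
  rw [Fintype.card_embedding_eq]
  simpa [Nat.pos_iff_ne_zero, Nat.descFactorial_eq_zero_iff_lt] using hk

theorem sum_embedding_succ (F : Finset (Fin n) → ℝ) :
    ∑ e : Fin (k + 1) ↪ Fin n, F (Finset.univ.map e) =
      ∑ e : Fin k ↪ Fin n, ∑ i ∈ (Finset.univ.map e)ᶜ, F (insert i (Finset.univ.map e)) := by
  classical
  rw [← (Equiv.embeddingFinSucc k (Fin n)).symm.sum_comp, Fintype.sum_sigma]
  refine Finset.sum_congr rfl fun e _ => ?_
  rw [Finset.sum_subtype (p := fun i => i ∉ Set.range e) (Finset.univ.map e)ᶜ (by simp)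
    (fun i => F (insert i (Finset.univ.map e)))]
  refine Finset.sum_congr rfl fun i _ => ?_
  congr 1
  ext x
  simp only [Finset.mem_map, Finset.mem_univ, true_and, Finset.mem_insert,
    Equiv.coe_embeddingFinSucc_symm, Fin.exists_fin_succ, Fin.cons_zero, Fin.cons_succ]
  tauto

/-- One-step conditioning: given the first `k` draws, the next is uniform on the `n - k` remaining
indices. -/
theorem samplingMean_succ_le (hk : k < n) {F G : Finset (Fin n) → ℝ}
    (h : ∀ S, S.card = k → ∑ i ∈ Sᶜ, F (insert i S) ≤ ((n : ℝ) - k) * G S) :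
    samplingMean n (k + 1) F ≤ samplingMean n k G := by
  have hpos : (0 : ℝ) < (n : ℝ) - k := sub_pos.2 (by exact_mod_cast hk)
  have hcard : (Fintype.card (Fin (k + 1) ↪ Fin n) : ℝ) =
      ((n : ℝ) - k) * Fintype.card (Fin k ↪ Fin n) := by
    simp only [Fintype.card_embedding_eq, Fintype.card_fin, Nat.descFactorial_succ, Nat.cast_mul,
      Nat.cast_sub hk.le]
  rw [samplingMean, samplingMean, hcard, sum_embedding_succ, div_mul_eq_div_div]
  refine div_le_div_of_nonneg_right ?_ (Nat.cast_nonneg _)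
  rw [div_le_iff₀ hpos, Finset.sum_mul]
  refine Finset.sum_le_sum fun e _ => ?_
  rw [mul_comm]
  exact h _ (by simp)

theorem samplingMean_affine (hk : k ≤ n) (F : Finset (Fin n) → ℝ) (a b : ℝ) :
    samplingMean n k (fun S => a * F S + b) = a * samplingMean n k F + b := by
  have := (card_embedding_pos hk).ne'
  rw [samplingMean, samplingMean, Finset.sum_add_distrib, ← Finset.mul_sum, Finset.sum_const,
    nsmul_eq_mul, Finset.card_univ]
  field_simp

theorem samplingMean_zero (F : Finset (Fin n) → ℝ) : samplingMean n 0 F = F ∅ := by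
  simp [samplingMean]

theorem samplingProb_mono {E E' : Set (Fin k ↪ Fin n)} (h : E ⊆ E') :
    samplingProb E ≤ samplingProb E' :=
  div_le_div_of_nonneg_right (by exact_mod_cast Set.ncard_le_ncard h (Set.toFinite _))
    (Nat.cast_nonneg _)

theorem samplingProb_le_of_subset_union {E E₁ E₂ : Set (Fin k ↪ Fin n)} (hk : k ≤ n)
    (h : Eᶜ ⊆ E₁ ∪ E₂) : 1 ≤ samplingProb E + samplingProb E₁ + samplingProb E₂ := by
  rw [samplingProb, samplingProb, samplingProb, ← add_div, ← add_div, Nat.card_eq_fintype_card,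
    le_div_iff₀ (card_embedding_pos hk), one_mul, ← Nat.card_eq_fintype_card,
    ← Set.ncard_add_ncard_compl E]
  have := (Set.ncard_le_ncard h (Set.toFinite _)).trans (Set.ncard_union_le E₁ E₂)
  norm_cast
  omega

theorem mul_samplingProb_le_samplingMean {F : Finset (Fin n) → ℝ} (hF : ∀ S, 0 ≤ F S) (a : ℝ) :
    a * samplingProb {e : Fin k ↪ Fin n | a ≤ F (Finset.univ.map e)} ≤ samplingMean n k F := by
  classical
  rw [samplingProb, samplingMean, ← mul_div_assoc, Nat.card_eq_fintype_card]
  refine div_le_div_of_nonneg_right ?_ (Nat.cast_nonneg _)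
  rw [Set.ncard_eq_toFinset_card', Set.toFinset_ofPred, mul_comm, ← nsmul_eq_mul]
  calc _ ≤ ∑ e with a ≤ F (Finset.univ.map e), F (Finset.univ.map e) :=
        Finset.card_nsmul_le_sum _ _ _ (by simp)
    _ ≤ _ := Finset.sum_le_sum_of_subset_of_nonneg (Finset.filter_subset _ _) fun _ _ _ => hF _

theorem samplingMean_sum (hk : k ≤ n) (b : Fin n → ℝ) :
    samplingMean n k (fun S => ∑ i ∈ S, b i) ≤ k / n * ∑ i, b i := by
  induction k with
  | zero => simp [samplingMean_zero]
  | succ k ih =>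
    have hkn : (0 : ℝ) < (n : ℝ) - k := sub_pos.2 (by exact_mod_cast hk)
    have hn : (0 : ℝ) < n := by exact_mod_cast (Nat.zero_le k).trans_lt hk
    refine (samplingMean_succ_le hk (G := fun S => (1 - 1 / ((n : ℝ) - k)) * ∑ i ∈ S, b i +
      (∑ i, b i) / ((n : ℝ) - k)) fun S hS => le_of_eq ?_).trans ?_
    · have e : ∀ i ∈ Sᶜ, ∑ j ∈ insert i S, b j = b i + ∑ j ∈ S, b j := fun i hi =>
        Finset.sum_insert (by simpa using hi)
      rw [Finset.sum_congr rfl e, Finset.sum_add_distrib, Finset.sum_const, Finset.card_compl, hS,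
        Fintype.card_fin, nsmul_eq_mul, Nat.cast_sub (by omega)]
      have := Finset.sum_add_sum_compl S b
      field_simp
      linarith
    · rw [samplingMean_affine (by omega)]
      have h1 : (0 : ℝ) ≤ 1 - 1 / ((n : ℝ) - k) := by
        rw [sub_nonneg, div_le_one hkn, le_sub_iff_add_le]
        exact_mod_cast (by omega : 1 + k ≤ n)
      refine (add_le_add_left (mul_le_mul_of_nonneg_left (ih (by omega)) h1) _).trans (le_of_eq ?_)
      push_cast
      field_simp
      ring

/-- The mean square of the sum of a sample without replacement from a centred population of
vectors is at most that of a sample with replacement. -/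
theorem samplingMean_dotProduct_sum_self {m : Type*} [Fintype m] (hk : k ≤ n) (a : Fin n → m → ℝ)
    (ha : ∑ i, a i = 0) :
    samplingMean n k (fun S => (∑ i ∈ S, a i) ⬝ᵥ (∑ i ∈ S, a i)) ≤
      k / n * ∑ i, a i ⬝ᵥ a i := by
  refine le_trans ?_ (samplingMean_sum hk fun i => a i ⬝ᵥ a i)
  -- With the diagonal removed, only cross terms remain, and their mean does not increase with `k`.
  suffices H : samplingMean n k (fun S => (∑ i ∈ S, a i) ⬝ᵥ (∑ i ∈ S, a i) -
      ∑ i ∈ S, a i ⬝ᵥ a i) ≤ 0 by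
    rw [samplingMean, Finset.sum_sub_distrib, sub_div] at H
    exact sub_nonpos.1 H
  induction k with
  | zero => simp [samplingMean_zero]
  | succ k ih =>
    refine (samplingMean_succ_le hk fun S hS => ?_).trans (ih (by omega))
    have e : ∀ i ∈ Sᶜ, (∑ j ∈ insert i S, a j) ⬝ᵥ (∑ j ∈ insert i S, a j) -
        ∑ j ∈ insert i S, a j ⬝ᵥ a j = ((∑ j ∈ S, a j) ⬝ᵥ (∑ j ∈ S, a j) -
        ∑ j ∈ S, a j ⬝ᵥ a j) + 2 * ((∑ j ∈ S, a j) ⬝ᵥ a i) := fun i hi => by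
      have hi : i ∉ S := by simpa using hi
      rw [Finset.sum_insert hi, Finset.sum_insert hi]
      simp only [dotProduct_add, add_dotProduct, dotProduct_comm (a i) (∑ j ∈ S, a j)]
      ring
    rw [Finset.sum_congr rfl e, Finset.sum_add_distrib, Finset.sum_const, Finset.card_compl, hS,
      Fintype.card_fin, nsmul_eq_mul, Nat.cast_sub (by omega), ← Finset.mul_sum, ← dotProduct_sum]
    -- By centring, the undrawn vectors sum to minus the drawn sum, so the new cross terms total −2
    -- times its squared norm.
    have hc : ∑ i ∈ Sᶜ, a i = -∑ i ∈ S, a i := by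
      rw [eq_neg_iff_add_eq_zero, add_comm, Finset.sum_add_sum_compl, ha]
    rw [hc, dotProduct_neg]
    have : 0 ≤ (∑ j ∈ S, a j) ⬝ᵥ (∑ j ∈ S, a j) :=
      Finset.sum_nonneg fun _ _ => mul_self_nonneg _
    linarith

end Sampling

/-! ### Resolvent identities and spectral bounds. -/

section Resolvent

variable {ι : Type*} [Fintype ι] [DecidableEq ι]

theorem inv_sub_inv_add {A K : Matrix ι ι ℝ} (hA : IsUnit A.det) (hA' : IsUnit (A + K).det) :
    A⁻¹ - (A + K)⁻¹ = A⁻¹ * K * (A + K)⁻¹ := by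
  have : A⁻¹ * ((A + K) - A) * (A + K)⁻¹ = A⁻¹ - (A + K)⁻¹ := by
    rw [mul_sub, sub_mul, mul_assoc, Matrix.mul_nonsing_inv _ hA', mul_one,
      Matrix.nonsing_inv_mul _ hA, one_mul]
  rw [← this, add_sub_cancel_left]

theorem inv_sub_inv_add' {A K : Matrix ι ι ℝ} (hA : IsUnit A.det) (hA' : IsUnit (A + K).det) :
    A⁻¹ - (A + K)⁻¹ = (A + K)⁻¹ * K * A⁻¹ := by
  have : (A + K)⁻¹ * ((A + K) - A) * A⁻¹ = A⁻¹ - (A + K)⁻¹ := by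
    rw [mul_sub, sub_mul, mul_assoc _ A, Matrix.mul_nonsing_inv _ hA, mul_one,
      Matrix.nonsing_inv_mul _ hA', one_mul]
  rw [← this, add_sub_cancel_left]

theorem quadForm_inv_le {A : Matrix ι ι ℝ} (hA : IsUnit A.det) {s : ℝ} (hs : 0 < s)
    (h : ∀ x : ι → ℝ, s * (x ⬝ᵥ x) ≤ x ⬝ᵥ (A *ᵥ x)) (u : ι → ℝ) :
    u ⬝ᵥ (A⁻¹ *ᵥ u) ≤ (u ⬝ᵥ u) / s := by
  set x := A⁻¹ *ᵥ u with hx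
  have hAx : A *ᵥ x = u := by
    rw [hx, Matrix.mulVec_mulVec, Matrix.mul_nonsing_inv _ hA, Matrix.one_mulVec]
  have h1 := h x
  rw [hAx, dotProduct_comm x u] at h1
  have h2 : 0 ≤ (u - s • x) ⬝ᵥ (u - s • x) := Finset.sum_nonneg fun _ _ => mul_self_nonneg _
  simp only [sub_dotProduct, dotProduct_sub, smul_dotProduct, dotProduct_smul, smul_eq_mul,
    dotProduct_comm x u] at h2
  rw [le_div_iff₀ hs]
  nlinarith

theorem inv_conj_diagonal {Q : Matrix ι ι ℝ} (hQ : Q * Qᵀ = 1) (hQ' : Qᵀ * Q = 1) {x : ι → ℝ}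
    (hx : ∀ i, x i ≠ 0) :
    (Q * Matrix.diagonal x * Qᵀ)⁻¹ = Q * Matrix.diagonal (fun i => (x i)⁻¹) * Qᵀ := by
  refine Matrix.inv_eq_right_inv ?_
  calc Q * Matrix.diagonal x * Qᵀ * (Q * Matrix.diagonal (fun i => (x i)⁻¹) * Qᵀ)
      = Q * Matrix.diagonal x * (Qᵀ * Q) * Matrix.diagonal (fun i => (x i)⁻¹) * Qᵀ := by
        simp only [mul_assoc]
    _ = 1 := by
        rw [hQ', mul_one, mul_assoc Q, Matrix.diagonal_mul_diagonal]
        simp [hx, hQ]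

theorem trace_conj_diagonal {Q : Matrix ι ι ℝ} (hQ' : Qᵀ * Q = 1) (x : ι → ℝ) :
    (Q * Matrix.diagonal x * Qᵀ).trace = ∑ i, x i := by
  rw [Matrix.trace_mul_comm, ← mul_assoc, hQ', one_mul, Matrix.trace_diagonal]

/-- The trace of the `q`-th power of the resolvent bounds the quadratic form from below. -/
theorem le_quadForm_of_trace_inv_pow_lt {A : Matrix ι ι ℝ} (hA : A.PosDef) {w : ℝ} (hw : 0 < w)
    {q : ℕ} (h : (A⁻¹ ^ q).trace < (w⁻¹) ^ q) (x : ι → ℝ) :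
    w * (x ⬝ᵥ x) ≤ x ⬝ᵥ (A *ᵥ x) := by
  obtain ⟨Q, l, hQ, hQ', hl, hAQ⟩ := exists_spectral_decomposition hA.posSemidef
  have hl' : ∀ i, 0 < l i := by
    intro i
    have hdet : A.det = ∏ i, l i := by
      rw [hAQ, Matrix.det_mul, Matrix.det_mul, mul_right_comm, ← Matrix.det_mul, hQ, Matrix.det_one, one_mul,
        Matrix.det_diagonal]
    refine (hl i).lt_of_ne' fun h0 => hA.det_pos.ne' ?_
    rw [hdet]
    exact Finset.prod_eq_zero (Finset.mem_univ i) h0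
  rw [hAQ, inv_conj_diagonal hQ hQ' (fun i => (hl' i).ne'), conj_diagonal_pow hQ hQ',
    trace_conj_diagonal hQ'] at h
  have hwl : ∀ i, w ≤ l i := by
    intro i
    by_contra hlt
    push Not at hlt
    have h1 : w⁻¹ ^ q ≤ (l i)⁻¹ ^ q :=
      pow_le_pow_left₀ (by positivity) (inv_anti₀ (hl' i) hlt.le) q
    have h2 : (l i)⁻¹ ^ q ≤ ∑ i, (l i)⁻¹ ^ q :=
      Finset.single_le_sum (f := fun i => (l i)⁻¹ ^ q)
        (fun j _ => pow_nonneg (inv_nonneg.2 (hl j)) q) (Finset.mem_univ i)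
    linarith
  have hxx : x ⬝ᵥ x = ∑ i, (Qᵀ *ᵥ x) i ^ 2 * 1 := by
    rw [← quadForm_conj_diagonal, Matrix.diagonal_one, mul_one, hQ, Matrix.one_mulVec]
  rw [hAQ, quadForm_conj_diagonal, hxx, Finset.mul_sum]
  refine Finset.sum_le_sum fun i _ => ?_
  nlinarith [sq_nonneg ((Qᵀ *ᵥ x) i), hwl i]

/-- Eigenvalue by eigenvalue, x^(q+1) ≥ τx^q − τ^(q+1): compare x with τ. This linearizes the
decrease of the potential. -/
theorem trace_pow_succ_ge {P : Matrix ι ι ℝ} (hP : P.PosSemidef) {τ : ℝ} (hτ : 0 ≤ τ) (q : ℕ) :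
    τ * (P ^ q).trace - Fintype.card ι * τ ^ (q + 1) ≤ (P ^ (q + 1)).trace := by
  obtain ⟨Q, x, hQ, hQ', hx, rfl⟩ := exists_spectral_decomposition hP
  simp only [conj_diagonal_pow hQ hQ', trace_conj_diagonal hQ']
  rw [Finset.mul_sum, ← nsmul_eq_mul, ← Finset.card_univ, ← Finset.sum_const,
    ← Finset.sum_sub_distrib]
  refine Finset.sum_le_sum fun i _ => ?_
  rw [pow_succ' τ, pow_succ' (x i)]
  rcases le_total (x i) τ with h | h
  · nlinarith [pow_le_pow_left₀ (hx i) h q, mul_nonneg (hx i) (pow_nonneg (hx i) q)]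
  · nlinarith [pow_nonneg (hx i) q, pow_nonneg hτ q, mul_nonneg hτ (pow_nonneg hτ q)]

theorem trace_pow_nonneg {P : Matrix ι ι ℝ} (hP : P.PosSemidef) (q : ℕ) : 0 ≤ (P ^ q).trace :=
  (hP.pow q).trace_nonneg

end Resolvent

/-! ### Mean contraction of the potential. -/

section Gram

variable {n d : ℕ}

/-- The Gram matrix `∑ i ∈ S, uᵢ uᵢᵀ` of the rows of `U` indexed by `S`. -/
noncomputable def rowGram (U : Matrix (Fin n) (Fin d) ℝ) (S : Finset (Fin n)) :
    Matrix (Fin d) (Fin d) ℝ :=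
  ∑ i ∈ S, Matrix.vecMulVec (U i) (U i)

theorem rowGram_univ (U : Matrix (Fin n) (Fin d) ℝ) : rowGram U Finset.univ = Uᵀ * U := by
  ext i j
  simp [rowGram, Matrix.sum_apply, Matrix.vecMulVec_apply, Matrix.mul_apply]

theorem quadForm_rowGram (U : Matrix (Fin n) (Fin d) ℝ) (S : Finset (Fin n)) (x : Fin d → ℝ) :
    x ⬝ᵥ (rowGram U S *ᵥ x) = ∑ i ∈ S, (U i ⬝ᵥ x) ^ 2 := by
  rw [rowGram, Matrix.sum_mulVec, dotProduct_sum]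
  refine Finset.sum_congr rfl fun i _ => ?_
  rw [Matrix.vecMulVec_mulVec]
  simp [dotProduct_comm x, sq]

theorem posSemidef_rowGram (U : Matrix (Fin n) (Fin d) ℝ) (S : Finset (Fin n)) :
    (rowGram U S).PosSemidef := by
  refine Matrix.posSemidef_sum S fun i _ => ?_
  simpa using Matrix.posSemidef_vecMulVec_self_star (U i)

/-- The regularized Gram matrix `s I + ∑ i ∈ S, uᵢ uᵢᵀ`. -/
noncomputable def ridgeGram (U : Matrix (Fin n) (Fin d) ℝ) (s : ℝ) (S : Finset (Fin n)) :
    Matrix (Fin d) (Fin d) ℝ :=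
  s • (1 : Matrix (Fin d) (Fin d) ℝ) + rowGram U S

theorem quadForm_ridgeGram (U : Matrix (Fin n) (Fin d) ℝ) (s : ℝ) (S : Finset (Fin n))
    (x : Fin d → ℝ) :
    x ⬝ᵥ (ridgeGram U s S *ᵥ x) = s * (x ⬝ᵥ x) + x ⬝ᵥ (rowGram U S *ᵥ x) := by
  simp [ridgeGram, Matrix.add_mulVec, Matrix.smul_mulVec]

theorem posDef_ridgeGram (U : Matrix (Fin n) (Fin d) ℝ) {s : ℝ} (hs : 0 < s)
    (S : Finset (Fin n)) : (ridgeGram U s S).PosDef :=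
  (Matrix.PosDef.one.smul hs).add_posSemidef (posSemidef_rowGram U S)

/-- One draw without replacement contracts the potential `tr (s I + ∑ i ∈ S, uᵢ uᵢᵀ)⁻ᵠ` on
average. -/
theorem sum_trace_inv_ridgeGram_insert_le {U : Matrix (Fin n) (Fin d) ℝ} (hU : Uᵀ * U = 1)
    {M s τ : ℝ} (hs : 0 < s) (hτ : 0 ≤ τ) {q : ℕ} (hM : ∀ i, U i ⬝ᵥ U i ≤ M)
    (hqM : 2 * q * M ≤ s) {k : ℕ} (hk : k < n) {S : Finset (Fin n)} (hS : S.card = k) :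
    ∑ i ∈ Sᶜ, ((ridgeGram U s (insert i S))⁻¹ ^ q).trace ≤ ((n : ℝ) - k) *
      ((1 - q * (τ - 1) / (2 * n)) * ((ridgeGram U s S)⁻¹ ^ q).trace +
        q * d * τ ^ (q + 1) / (2 * n)) := by
  set A := ridgeGram U s S with hA
  have hApd : A.PosDef := posDef_ridgeGram U hs S
  have hAu : IsUnit A.det := (Matrix.isUnit_iff_isUnit_det _).1 hApd.isUnit
  have hP : (A⁻¹).PosSemidef := hApd.posSemidef.inv
  have step : ∀ i ∈ Sᶜ, ((ridgeGram U s (insert i S))⁻¹ ^ q).trace ≤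
      (A⁻¹ ^ q).trace - q / 2 * (U i ⬝ᵥ (A⁻¹ ^ (q + 1) *ᵥ U i)) := by
    intro i hi
    have hi : i ∉ S := by simpa using hi
    have e : ridgeGram U s (insert i S) = A + Matrix.vecMulVec (U i) (U i) := by
      rw [hA, ridgeGram, ridgeGram, rowGram, rowGram, Finset.sum_insert hi]; abel
    have hpd := posDef_ridgeGram U hs (insert i S)
    rw [e] at hpd ⊢
    have hu := (Matrix.isUnit_iff_isUnit_det _).1 hpd.isUnit
    have := trace_pow_sub_trace_pow_ge hP hpd.posSemidef.inv (inv_sub_inv_add hAu hu)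
      (inv_sub_inv_add' hAu hu) q
    have hg : U i ⬝ᵥ (A⁻¹ *ᵥ U i) ≤ M / s := by
      refine (quadForm_inv_le hAu hs (fun x => ?_) (U i)).trans
        (div_le_div_of_nonneg_right (hM i) hs.le)
      rw [hA, quadForm_ridgeGram]
      have := (posSemidef_rowGram U S).dotProduct_mulVec_nonneg x
      simp only [star_trivial] at this
      linarith
    have hq : q * (U i ⬝ᵥ (A⁻¹ *ᵥ U i)) ≤ 1 / 2 := by
      refine (mul_le_mul_of_nonneg_left hg (Nat.cast_nonneg q)).trans ?_
      rw [← mul_div_assoc, div_le_div_iff₀ hs two_pos]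
      linarith
    have h3 : (q : ℝ) / 2 * (U i ⬝ᵥ (A⁻¹ ^ (q + 1) *ᵥ U i)) ≤
        q * (1 - q * (U i ⬝ᵥ (A⁻¹ *ᵥ U i))) * (U i ⬝ᵥ (A⁻¹ ^ (q + 1) *ᵥ U i)) := by
      refine mul_le_mul_of_nonneg_right ?_ (quadForm_pow_nonneg hP _ _)
      rw [div_eq_mul_inv]
      exact mul_le_mul_of_nonneg_left (by linarith) (Nat.cast_nonneg q)
    linarith
  refine (Finset.sum_le_sum step).trans ?_
  rw [Finset.sum_sub_distrib, Finset.sum_const, Finset.card_compl, hS, Fintype.card_fin,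
    nsmul_eq_mul, Nat.cast_sub hk.le, ← Finset.mul_sum]
  set X := ∑ i ∈ Sᶜ, U i ⬝ᵥ (A⁻¹ ^ (q + 1) *ᵥ U i) with hX
  have hX0 : 0 ≤ X := Finset.sum_nonneg fun i _ => quadForm_pow_nonneg hP _ _
  -- The undrawn rows have Gram matrix I − G = (1 + s)I − A. Sampling without replacement thus costs
  -- only one tr P^q, against the gain τ tr P^q.
  have hXeq : X = (1 + s) * (A⁻¹ ^ (q + 1)).trace - (A⁻¹ ^ q).trace := by
    have e1 : X = (A⁻¹ ^ (q + 1) * rowGram U Sᶜ).trace := by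
      rw [rowGram, Finset.mul_sum, Matrix.trace_sum]
      refine Finset.sum_congr rfl fun i _ => ?_
      rw [Matrix.mul_vecMulVec, Matrix.trace_vecMulVec, dotProduct_comm]
    have e2 : rowGram U Sᶜ = (1 + s) • (1 : Matrix (Fin d) (Fin d) ℝ) - A := by
      have : rowGram U S + rowGram U Sᶜ = 1 := by
        rw [← hU, ← rowGram_univ]; exact Finset.sum_add_sum_compl S _
      rw [hA, ridgeGram, eq_sub_of_add_eq' this, add_smul, one_smul]; abel
    rw [e1, e2, mul_sub, Matrix.trace_sub, pow_succ A⁻¹ q, mul_assoc (A⁻¹ ^ q) A⁻¹ A,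
      Matrix.nonsing_inv_mul _ hAu, mul_one, Matrix.mul_smul, mul_one, Matrix.trace_smul,
      smul_eq_mul]
  have hY : (τ - 1) * (A⁻¹ ^ q).trace - d * τ ^ (q + 1) ≤ X := by
    have := trace_pow_succ_ge hP hτ q
    rw [Fintype.card_fin] at this
    nlinarith [mul_nonneg hs.le (trace_pow_nonneg hP (q + 1))]
  have hn : (0 : ℝ) < n := by exact_mod_cast (Nat.zero_le k).trans_lt hk
  have hkn : (0 : ℝ) < (n : ℝ) - k := sub_pos.2 (by exact_mod_cast hk)
  -- The factor (n − k)/n makes the contraction rate independent of `k`. Since `X ≥ 0`, this holds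
  -- even if the bracket is negative.
  have hXn : ((n : ℝ) - k) / n * ((τ - 1) * (A⁻¹ ^ q).trace - d * τ ^ (q + 1)) ≤ X := by
    have h1 : ((n : ℝ) - k) / n ≤ 1 := by
      rw [div_le_one hn]; linarith [(Nat.cast_nonneg k : (0 : ℝ) ≤ k)]
    calc _ ≤ ((n : ℝ) - k) / n * X := mul_le_mul_of_nonneg_left hY (by positivity)
      _ ≤ X := mul_le_of_le_one_left hX0 h1
  have h4 := mul_le_mul_of_nonneg_left hXn (by positivity : (0 : ℝ) ≤ q / 2)
  refine (sub_le_sub_left h4 _).trans (le_of_eq ?_)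
  field_simp
  ring

theorem samplingMean_trace_inv_ridgeGram_le {U : Matrix (Fin n) (Fin d) ℝ} (hU : Uᵀ * U = 1)
    {M s τ : ℝ} (hs : 0 < s) (hτ : 1 < τ) {q : ℕ} (hM : ∀ i, U i ⬝ᵥ U i ≤ M)
    (hqM : 2 * q * M ≤ s) (ha : q * (τ - 1) / (2 * n) ≤ 1) {k : ℕ} (hk : k ≤ n) :
    samplingMean n k (fun S => ((ridgeGram U s S)⁻¹ ^ q).trace) ≤
      (1 - q * (τ - 1) / (2 * n)) ^ k * (d * s⁻¹ ^ q) + d * τ ^ (q + 1) / (τ - 1) := by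
  have hτ' : 0 < τ - 1 := sub_pos.2 hτ
  induction k with
  | zero =>
    rw [samplingMean_zero, ridgeGram, rowGram, Finset.sum_empty, add_zero]
    have : (s • (1 : Matrix (Fin d) (Fin d) ℝ))⁻¹ = s⁻¹ • 1 := by
      refine Matrix.inv_eq_right_inv ?_
      rw [Matrix.smul_mul, Matrix.mul_smul, smul_smul, mul_inv_cancel₀ hs.ne', one_smul, mul_one]
    rw [this, smul_pow, one_pow, Matrix.trace_smul, Matrix.trace_one, Fintype.card_fin, smul_eq_mul,
      pow_zero, one_mul, mul_comm]
    have : 0 ≤ d * τ ^ (q + 1) / (τ - 1) := by positivity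
    linarith
  | succ k ih =>
    have hn : (0 : ℝ) < n := by exact_mod_cast (Nat.zero_le k).trans_lt hk
    refine (samplingMean_succ_le hk fun S hS =>
      sum_trace_inv_ridgeGram_insert_le hU hs (zero_le_one.trans hτ.le) hM hqM hk hS).trans ?_
    rw [samplingMean_affine (by omega)]
    refine (add_le_add_left (mul_le_mul_of_nonneg_left (ih (by omega)) (sub_nonneg.2 ha)) _).trans
      (le_of_eq ?_)
    -- d τ^(q+1)/(τ − 1) is the fixed point of the affine recursion.
    have hb : q * d * τ ^ (q + 1) / (2 * n) =
        q * (τ - 1) / (2 * n) * (d * τ ^ (q + 1) / (τ - 1)) := by field_simp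
    rw [hb]
    ring

end Gram

/-! ### Tail bounds for the two events. -/

section Concentration

variable {n d c : ℕ}

theorem sum_dotProduct_self_rows {U : Matrix (Fin n) (Fin d) ℝ} (hU : Uᵀ * U = 1) :
    ∑ i, U i ⬝ᵥ U i = d := by
  have : (rowGram U Finset.univ).trace = d := by
    rw [rowGram_univ, hU, Matrix.trace_one, Fintype.card_fin]
  rw [← this, rowGram, Matrix.trace_sum]
  simp only [Matrix.trace_vecMulVec]

theorem le_mul_of_dotProduct_self_rows_le {U : Matrix (Fin n) (Fin d) ℝ} (hU : Uᵀ * U = 1) {M : ℝ}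
    (hM : ∀ i, U i ⬝ᵥ U i ≤ M) : (d : ℝ) ≤ n * M := by
  rw [← sum_dotProduct_self_rows hU]
  simpa using Finset.sum_le_card_nsmul Finset.univ _ M fun i _ => hM i

/-- A lower-tail matrix Chernoff bound for row sampling without replacement. -/
theorem samplingProb_quadForm_rowGram_lt_le (hd : 0 < d) (hcn : c ≤ n)
    {U : Matrix (Fin n) (Fin d) ℝ} (hU : Uᵀ * U = 1) {M : ℝ} (hM : ∀ i, U i ⬝ᵥ U i ≤ M)
    (hc : 1000 * (n * M) * (Real.log d + 7) ≤ c) :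
    samplingProb {e : Fin c ↪ Fin n | ¬ ∀ x : Fin d → ℝ, (c : ℝ) / n / 40 * (x ⬝ᵥ x) ≤
      x ⬝ᵥ (rowGram U (Finset.univ.map e) *ᵥ x)} ≤ 1 / 20 := by
  have hd1 : (1 : ℝ) ≤ d := by exact_mod_cast hd
  have hnM : (d : ℝ) ≤ n * M := le_mul_of_dotProduct_self_rows_le hU hM
  have hlog : 0 ≤ Real.log d := Real.log_nonneg hd1
  -- The upper bound on `q` lets `hc` control `q`; the lower bound gives d e^(−q) ≤ e^(−6).
  set q := ⌊Real.log d + 7⌋₊ with hq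
  have hq1 : (q : ℝ) ≤ Real.log d + 7 := Nat.floor_le (by linarith)
  have hq2 : Real.log d + 6 < q := by
    have := Nat.lt_floor_add_one (Real.log d + 7)
    linarith
  have hq0 : (0 : ℝ) ≤ q := Nat.cast_nonneg q
  have hcq : 1000 * (n * M) * q ≤ c :=
    (mul_le_mul_of_nonneg_left hq1 (by linarith)).trans hc
  have hcq' : 1000 * (q : ℝ) ≤ c := by nlinarith
  have hc0 : (0 : ℝ) < c := by linarith
  have hcn' : (c : ℝ) ≤ n := by exact_mod_cast hcn
  have hn0 : (0 : ℝ) < n := by linarith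
  set p : ℝ := c / n with hp
  have hp0 : 0 < p := by positivity
  have hp1 : p ≤ 1 := (div_le_one hn0).2 hcn'
  have hpn : p * n = c := by rw [hp]; field_simp
  have hs : 0 < p / 400 := by positivity
  have hτ : 11 ≤ 11 / p := by rw [le_div_iff₀ hp0]; linarith
  have hqM : 2 * q * M ≤ p / 400 := by
    have : 1000 * M * q ≤ p := by rw [hp, le_div_iff₀ hn0]; linarith
    linarith
  have haeq : q * (11 / p - 1) / (2 * n) * c = q * (11 - p) / 2 := by
    rw [← hpn]; field_simp
  have ha : q * (11 / p - 1) / (2 * n) ≤ 1 := by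
    have : q * (11 / p - 1) / (2 * n) * c ≤ 1 * c := by
      rw [haeq]; nlinarith
    exact le_of_mul_le_mul_right this hc0
  have hmean := samplingMean_trace_inv_ridgeGram_le hU hs (by linarith : 1 < 11 / p) hM hqM ha hcn
  -- With s = p/400, w − s = p/40. With τ = 11/p, the c draws contract by e^(−5q), which beats
  -- (w/s)^q = 11^q, while (τw)^q = (121/400)^q is also below e^(−q). The total is at most 3d e^(−q)
  -- ≤ 3/64.
  set w : ℝ := 11 * p / 400 with hw
  have hw0 : 0 < w := by positivity
  have hmarkov := mul_samplingProb_le_samplingMean (k := c)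
    (F := fun S => ((ridgeGram U (p / 400) S)⁻¹ ^ q).trace)
    (fun S => trace_pow_nonneg (posDef_ridgeGram U hs S).posSemidef.inv q) (w⁻¹ ^ q)
  refine (samplingProb_mono (E' := {e : Fin c ↪ Fin n | w⁻¹ ^ q ≤
    ((ridgeGram U (p / 400) (Finset.univ.map e))⁻¹ ^ q).trace}) fun e he => ?_).trans ?_
  · by_contra hlt
    simp only [Set.mem_ofPred_eq, not_le] at hlt
    refine he fun x => ?_
    have := le_quadForm_of_trace_inv_pow_lt (posDef_ridgeGram U hs _) hw0 hlt x
    rw [quadForm_ridgeGram, hw] at this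
    linarith
  have hexp1 : Real.exp 1 ≤ 3 := Real.exp_one_lt_three.le
  have hexp2 : (2 : ℝ) ≤ Real.exp 1 := by linarith [Real.add_one_le_exp (1 : ℝ)]
  have hde : d * Real.exp (-1) ^ q ≤ 1 / 64 := by
    have h1 : (d : ℝ) * Real.exp (-1) ^ q = Real.exp (Real.log d - q) := by
      rw [← Real.exp_nat_mul, sub_eq_add_neg, Real.exp_add, Real.exp_log (by linarith)]
      ring_nf
    have h2 : Real.exp (-6) ≤ 1 / 64 := by
      have : Real.exp (-6) = (Real.exp 1 ^ 6)⁻¹ := by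
        rw [Real.exp_neg, ← Real.exp_nat_mul]; norm_num
      rw [this, one_div]
      refine inv_anti₀ (by norm_num) ?_
      calc (64 : ℝ) = 2 ^ 6 := by norm_num
        _ ≤ _ := pow_le_pow_left₀ (by norm_num) hexp2 6
    rw [h1]
    exact (Real.exp_le_exp.2 (by linarith)).trans h2
  have hterm1 : (1 - q * (11 / p - 1) / (2 * n)) ^ c * (d * (p / 400)⁻¹ ^ q) * w ^ q ≤
      d * Real.exp (-1) ^ q := by
    have h1 : (1 - q * (11 / p - 1) / (2 * n)) ^ c ≤ Real.exp (-5) ^ q := by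
      refine (pow_le_pow_left₀ (sub_nonneg.2 ha) (Real.one_sub_le_exp_neg _) c).trans ?_
      rw [← Real.exp_nat_mul, ← Real.exp_nat_mul, Real.exp_le_exp]
      nlinarith [haeq]
    have h2 : (p / 400)⁻¹ ^ q * w ^ q = 11 ^ q := by
      rw [← mul_pow, hw]; congr 1; field_simp
    have h3 : Real.exp (-5) * 11 ≤ Real.exp (-1) := by
      have : Real.exp (-1) = Real.exp (-5) * Real.exp 1 ^ 4 := by
        rw [← Real.exp_nat_mul, ← Real.exp_add]; norm_num
      rw [this]
      refine mul_le_mul_of_nonneg_left ?_ (Real.exp_pos _).le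
      calc (11 : ℝ) ≤ 2 ^ 4 := by norm_num
        _ ≤ _ := pow_le_pow_left₀ (by norm_num) hexp2 4
    calc _ = (1 - q * (11 / p - 1) / (2 * n)) ^ c * (d * ((p / 400)⁻¹ ^ q * w ^ q)) := by ring
      _ ≤ Real.exp (-5) ^ q * (d * 11 ^ q) := by
          rw [h2]; exact mul_le_mul_of_nonneg_right h1 (by positivity)
      _ = d * (Real.exp (-5) * 11) ^ q := by rw [mul_pow]; ring
      _ ≤ _ := mul_le_mul_of_nonneg_left (pow_le_pow_left₀ (by positivity) h3 q) (by linarith)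
  have hterm2 : d * (11 / p) ^ (q + 1) / (11 / p - 1) * w ^ q ≤ 2 * (d * Real.exp (-1) ^ q) := by
    have h1 : (11 / p) ^ q * w ^ q = (121 / 400) ^ q := by
      rw [← mul_pow, hw]; congr 1; field_simp; norm_num
    have h2 : 11 / p / (11 / p - 1) ≤ 2 := by
      rw [div_le_iff₀ (by linarith)]; linarith
    have h3 : (121 / 400 : ℝ) ≤ Real.exp (-1) := by
      rw [Real.exp_neg]
      exact (by norm_num : (121 / 400 : ℝ) ≤ 3⁻¹).trans (inv_anti₀ (Real.exp_pos 1) hexp1)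
    calc _ = 11 / p / (11 / p - 1) * (d * ((11 / p) ^ q * w ^ q)) := by rw [pow_succ]; ring
      _ ≤ 2 * (d * ((11 / p) ^ q * w ^ q)) := mul_le_mul_of_nonneg_right h2 (by positivity)
      _ ≤ _ := by
          rw [h1]
          exact mul_le_mul_of_nonneg_left (mul_le_mul_of_nonneg_left
            (pow_le_pow_left₀ (by norm_num) h3 q) (by linarith)) (by norm_num)
  have hfin := mul_le_mul_of_nonneg_right (hmarkov.trans hmean) (pow_nonneg hw0.le q)
  rw [mul_right_comm, ← mul_pow, inv_mul_cancel₀ hw0.ne', one_pow, one_mul, add_mul] at hfin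
  refine hfin.trans ?_
  linarith

theorem samplingProb_dotProduct_sum_self_gt_le (hd : 0 < d) (hcn : c ≤ n)
    {U : Matrix (Fin n) (Fin d) ℝ} (hU : Uᵀ * U = 1) {M : ℝ} (hM : ∀ i, U i ⬝ᵥ U i ≤ M)
    (hc : 7000 * (n * M) ≤ c) {r : Fin n → ℝ} (hr : ∑ i, r i • U i = 0) :
    samplingProb {e : Fin c ↪ Fin n | 1.2 * (((c : ℝ) / n / 40) ^ 2 * (r ⬝ᵥ r)) <
      (∑ i ∈ Finset.univ.map e, r i • U i) ⬝ᵥ (∑ i ∈ Finset.univ.map e, r i • U i)} ≤ 1 / 5 := by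
  have hd1 : (1 : ℝ) ≤ d := by exact_mod_cast hd
  have hnM : (d : ℝ) ≤ n * M := le_mul_of_dotProduct_self_rows_le hU hM
  have hc0 : (0 : ℝ) < c := by linarith
  have hn0 : (0 : ℝ) < n := hc0.trans_le (by exact_mod_cast hcn)
  set p : ℝ := c / n with hp
  have hp0 : 0 < p := by positivity
  have hMp : 7000 * M ≤ p := by rw [hp, le_div_iff₀ hn0]; linarith
  -- For r = 0 Markov's threshold vanishes, but the strict event is empty.
  rcases eq_or_ne r 0 with rfl | hr0
  · simp [samplingProb]
  have hR : 0 < r ⬝ᵥ r := lt_of_le_of_ne (Finset.sum_nonneg fun _ _ => mul_self_nonneg _)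
    fun h => hr0 (dotProduct_self_eq_zero.1 h.symm)
  have hmean := samplingMean_dotProduct_sum_self hcn (fun i => r i • U i) hr
  have hsum : ∑ i, (r i • U i) ⬝ᵥ (r i • U i) ≤ M * (r ⬝ᵥ r) := by
    rw [dotProduct, Finset.mul_sum]
    refine Finset.sum_le_sum fun i _ => ?_
    simp only [smul_dotProduct, dotProduct_smul, smul_eq_mul]
    nlinarith [mul_self_nonneg (r i), hM i]
  have hmarkov := mul_samplingProb_le_samplingMean (k := c)
    (F := fun S => (∑ i ∈ S, r i • U i) ⬝ᵥ (∑ i ∈ S, r i • U i))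
    (fun S => Finset.sum_nonneg fun _ _ => mul_self_nonneg _) (1.2 * ((p / 40) ^ 2 * (r ⬝ᵥ r)))
  have hθ : 0 < 1.2 * ((p / 40) ^ 2 * (r ⬝ᵥ r)) := by positivity
  set θ := 1.2 * ((p / 40) ^ 2 * (r ⬝ᵥ r)) with hθdef
  refine (samplingProb_mono (E' := {e : Fin c ↪ Fin n | θ ≤
    (∑ i ∈ Finset.univ.map e, r i • U i) ⬝ᵥ (∑ i ∈ Finset.univ.map e, r i • U i)})
    fun e he => ?_).trans ?_
  · exact le_of_lt (Set.mem_ofPred_eq ▸ he)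
  refine le_of_mul_le_mul_left ((hmarkov.trans hmean).trans ?_) hθ
  rw [hθdef]
  calc p * ∑ i, (r i • U i) ⬝ᵥ (r i • U i) ≤ p * (p / 7000 * (r ⬝ᵥ r)) := by
        refine mul_le_mul_of_nonneg_left (hsum.trans ?_) hp0.le
        exact mul_le_mul_of_nonneg_right (by linarith) hR.le
    -- 1/7000 ≤ (1/5) · 1.2/1600.
    _ ≤ _ := by nlinarith [mul_pos (mul_pos hp0 hp0) hR]

end Concentration

/-! ### Deterministic least squares bounds. -/

section LeastSquares

theorem l2norm_sq {ι : Type*} [Fintype ι] (v : ι → ℝ) : l2norm v ^ 2 = v ⬝ᵥ v := by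
  rw [l2norm, EuclideanSpace.real_norm_sq_eq]
  simp [dotProduct, sq]

theorem IsLeastSquaresSolution.dotProduct_mulVec_eq_zero {m d : ℕ} {A : Matrix (Fin m) (Fin d) ℝ}
    {b : Fin m → ℝ} {β : Fin d → ℝ} (h : IsLeastSquaresSolution A b β) (v : Fin d → ℝ) :
    (b - A *ᵥ β) ⬝ᵥ (A *ᵥ v) = 0 := by
  set a := (b - A *ᵥ β) ⬝ᵥ (A *ᵥ v) with ha
  set B := (A *ᵥ v) ⬝ᵥ (A *ᵥ v) with hB
  have hB0 : 0 ≤ B := Finset.sum_nonneg fun _ _ => mul_self_nonneg _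
  -- `B + 1` avoids division by zero; minimality at this step forces t²(B + 2) ≤ 0.
  set t := a / (B + 1) with ht
  have h1 := h (β + t • v)
  rw [l2norm_sq, l2norm_sq, Matrix.mulVec_add, Matrix.mulVec_smul, ← sub_sub] at h1
  set ρ := b - A *ᵥ β
  simp only [sub_dotProduct ρ, dotProduct_sub, smul_dotProduct, dotProduct_smul, smul_eq_mul,
    dotProduct_comm (A *ᵥ v) ρ, ← ha, ← hB] at h1
  have hat : a = t * (B + 1) := by rw [ht]; field_simp
  have : t * t * (B + 2) ≤ 0 := by rw [hat] at h1; nlinarith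
  have ht0 : t = 0 := by
    by_contra hne
    nlinarith [mul_self_pos.2 hne]
  rw [hat, ht0, zero_mul]

variable {n d c : ℕ} {X U : Matrix (Fin n) (Fin d) ℝ} {σ : Fin d → ℝ}
  {V : Matrix (Fin d) (Fin d) ℝ}

theorem samplingMatrix_mulVec (e : Fin c ↪ Fin n) (v : Fin n → ℝ) :
    samplingMatrix e *ᵥ v = v ∘ e := by
  ext k
  simp [samplingMatrix, Matrix.mulVec, dotProduct, Matrix.submatrix_apply, Matrix.one_apply]

theorem dotProduct_comp_embedding (e : Fin c ↪ Fin n) (v w : Fin n → ℝ) :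
    (v ∘ e) ⬝ᵥ (w ∘ e) = ∑ i ∈ Finset.univ.map e, v i * w i := by
  simp [dotProduct]

theorem mulVec_dotProduct_mulVec_self {m : ℕ} {W : Matrix (Fin m) (Fin d) ℝ} (hW : Wᵀ * W = 1)
    (z : Fin d → ℝ) : (W *ᵥ z) ⬝ᵥ (W *ᵥ z) = z ⬝ᵥ z := by
  rw [Matrix.dotProduct_mulVec, ← Matrix.mulVec_transpose, Matrix.mulVec_mulVec, hW,
    Matrix.one_mulVec]

theorem sigmaMin_le (hd : 0 < d) (hσ : Antitone σ) (j : Fin d) : sigmaMin hd σ ≤ σ j :=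
  hσ (Fin.le_def.2 (Nat.le_sub_one_of_lt j.2))

theorem le_sigmaMax (hd : 0 < d) (hσ : Antitone σ) (j : Fin d) : σ j ≤ sigmaMax hd σ :=
  hσ (Fin.le_def.2 (Nat.zero_le _))

theorem IsThinSVD.mulVec_eq (hX : IsThinSVD X U σ V) (v : Fin d → ℝ) :
    X *ᵥ v = U *ᵥ (fun j => σ j * (Vᵀ *ᵥ v) j) := by
  rw [hX.eq_mul, ← Matrix.mulVec_mulVec, ← Matrix.mulVec_mulVec]
  congr 1
  ext j
  rw [Matrix.mulVec_diagonal]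

theorem IsThinSVD.transpose_mulVec_dotProduct_self (hX : IsThinSVD X U σ V) (v : Fin d → ℝ) :
    (Vᵀ *ᵥ v) ⬝ᵥ (Vᵀ *ᵥ v) = v ⬝ᵥ v :=
  mulVec_dotProduct_mulVec_self (by
    rw [Matrix.transpose_transpose]; exact mul_eq_one_comm.1 hX.orthogonal_right) v

theorem IsThinSVD.sigmaMin_sq_mul_le (hX : IsThinSVD X U σ V) (hd : 0 < d)
    (hrank : 0 < sigmaMin hd σ) (v : Fin d → ℝ) :
    sigmaMin hd σ ^ 2 * (v ⬝ᵥ v) ≤ (X *ᵥ v) ⬝ᵥ (X *ᵥ v) := by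
  rw [hX.mulVec_eq, mulVec_dotProduct_mulVec_self hX.orthonormal_left,
    ← hX.transpose_mulVec_dotProduct_self v, dotProduct, dotProduct, Finset.mul_sum]
  refine Finset.sum_le_sum fun j _ => ?_
  have := pow_le_pow_left₀ hrank.le (sigmaMin_le hd hX.antitone j) 2
  nlinarith [mul_le_mul_of_nonneg_right this (mul_self_nonneg ((Vᵀ *ᵥ v) j))]

theorem IsThinSVD.le_sigmaMax_sq_mul (hX : IsThinSVD X U σ V) (hd : 0 < d) (v : Fin d → ℝ) :
    (X *ᵥ v) ⬝ᵥ (X *ᵥ v) ≤ sigmaMax hd σ ^ 2 * (v ⬝ᵥ v) := by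
  rw [hX.mulVec_eq, mulVec_dotProduct_mulVec_self hX.orthonormal_left,
    ← hX.transpose_mulVec_dotProduct_self v, dotProduct, dotProduct, Finset.mul_sum]
  refine Finset.sum_le_sum fun j _ => ?_
  have := pow_le_pow_left₀ (hX.nonneg j) (le_sigmaMax hd hX.antitone j) 2
  nlinarith [mul_le_mul_of_nonneg_right this (mul_self_nonneg ((Vᵀ *ᵥ v) j))]

/-- The least squares residual is orthogonal to the columns of the left singular factor. -/
theorem IsThinSVD.residual_dotProduct_mulVec (hX : IsThinSVD X U σ V) (hd : 0 < d)
    (hrank : 0 < sigmaMin hd σ) {y : Fin n → ℝ} {β : Fin d → ℝ}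
    (hβ : IsLeastSquaresSolution X y β) (z : Fin d → ℝ) : (y - X *ᵥ β) ⬝ᵥ (U *ᵥ z) = 0 := by
  have : X *ᵥ (V *ᵥ fun j => (σ j)⁻¹ * z j) = U *ᵥ z := by
    rw [hX.mulVec_eq, Matrix.mulVec_mulVec, hX.orthogonal_right, Matrix.one_mulVec]
    congr 1
    ext j
    rw [mul_inv_cancel_left₀ (hrank.trans_le (sigmaMin_le hd hX.antitone j)).ne']
  rw [← this]
  exact hβ.dotProduct_mulVec_eq_zero _

theorem IsThinSVD.sum_residual_smul (hX : IsThinSVD X U σ V) (hd : 0 < d)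
    (hrank : 0 < sigmaMin hd σ) {y : Fin n → ℝ} {β : Fin d → ℝ}
    (hβ : IsLeastSquaresSolution X y β) : ∑ i, (y - X *ᵥ β) i • U i = 0 := by
  ext j
  have := hX.residual_dotProduct_mulVec hd hrank hβ (Pi.single j 1)
  rw [Matrix.mulVec_single_one] at this
  simpa [dotProduct, Finset.sum_apply] using this

/-- Error bounds for sketched least squares under a subspace-embedding condition and a bound on
the sketched residual. -/
theorem IsThinSVD.sampled_solution_bounds (hX : IsThinSVD X U σ V) (hd : 0 < d)
    (hrank : 0 < sigmaMin hd σ) {y : Fin n → ℝ} {β : Fin d → ℝ}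
    (hβ : IsLeastSquaresSolution X y β) {e : Fin c ↪ Fin n} {δ ε : ℝ} (hδ : 0 < δ)
    (hemb : ∀ x : Fin d → ℝ, δ * (x ⬝ᵥ x) ≤ x ⬝ᵥ (rowGram U (Finset.univ.map e) *ᵥ x))
    (hres : (∑ i ∈ Finset.univ.map e, (y - X *ᵥ β) i • U i) ⬝ᵥ
      (∑ i ∈ Finset.univ.map e, (y - X *ᵥ β) i • U i) ≤
        ε * (δ ^ 2 * ((y - X *ᵥ β) ⬝ᵥ (y - X *ᵥ β))))
    {βS : Fin d → ℝ}
    (hβS : IsLeastSquaresSolution (samplingMatrix e * X) (samplingMatrix e *ᵥ y) βS) :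
    l2norm (y - X *ᵥ βS) ^ 2 ≤ (1 + ε) * l2norm (y - X *ᵥ β) ^ 2 ∧
      l2norm (β - βS) ^ 2 ≤ ε / sigmaMin hd σ ^ 2 * l2norm (y - X *ᵥ β) ^ 2 := by
  set r := y - X *ᵥ β with hr
  set S := Finset.univ.map e
  set z : Fin d → ℝ := fun j => σ j * (Vᵀ *ᵥ (βS - β)) j with hz
  have hXz : X *ᵥ (βS - β) = U *ᵥ z := hX.mulVec_eq _
  have hyS : y - X *ᵥ βS = r - U *ᵥ z := by
    rw [← hXz, hr, Matrix.mulVec_sub]; abel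
  have hUz : ∀ i, (U *ᵥ z) i = U i ⬝ᵥ z := fun i => rfl
  set T := ∑ i ∈ S, r i • U i with hT
  have hnormal : z ⬝ᵥ (rowGram U S *ᵥ z) = T ⬝ᵥ z := by
    have h := hβS.dotProduct_mulVec_eq_zero (βS - β)
    rw [← Matrix.mulVec_mulVec, ← Matrix.mulVec_mulVec, ← Matrix.mulVec_sub, hXz, hyS,
      samplingMatrix_mulVec, samplingMatrix_mulVec, dotProduct_comp_embedding] at h
    rw [quadForm_rowGram, hT, sum_dotProduct, ← sub_eq_zero, ← Finset.sum_sub_distrib,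
      ← neg_eq_zero, ← Finset.sum_neg_distrib, ← h]
    refine Finset.sum_congr rfl fun i _ => ?_
    rw [Pi.sub_apply, hUz, smul_dotProduct, smul_eq_mul]; ring
  have hzz : z ⬝ᵥ z ≤ ε * (r ⬝ᵥ r) := by
    have h1 := hemb z
    rw [hnormal] at h1
    have h2 : 0 ≤ (T - δ • z) ⬝ᵥ (T - δ • z) := Finset.sum_nonneg fun _ _ => mul_self_nonneg _
    simp only [sub_dotProduct, dotProduct_sub, smul_dotProduct, dotProduct_smul, smul_eq_mul,
      dotProduct_comm z T] at h2
    have h3 : δ ^ 2 * (z ⬝ᵥ z) ≤ δ ^ 2 * (ε * (r ⬝ᵥ r)) := by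
      nlinarith [mul_le_mul_of_nonneg_left h1 hδ.le]
    exact le_of_mul_le_mul_left h3 (by positivity)
  have hzU : (U *ᵥ z) ⬝ᵥ (U *ᵥ z) = z ⬝ᵥ z := mulVec_dotProduct_mulVec_self hX.orthonormal_left z
  simp only [l2norm_sq]
  constructor
  · have horth : r ⬝ᵥ (U *ᵥ z) = 0 := hX.residual_dotProduct_mulVec hd hrank hβ z
    rw [hyS]
    simp only [sub_dotProduct r, dotProduct_sub, dotProduct_comm (U *ᵥ z) r, horth, hzU]
    linarith
  · have h1 := hX.sigmaMin_sq_mul_le hd hrank (βS - β)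
    rw [hXz, hzU] at h1
    have h2 : (β - βS) ⬝ᵥ (β - βS) = (βS - β) ⬝ᵥ (βS - β) := by
      rw [← neg_sub βS β, neg_dotProduct, dotProduct_neg, neg_neg]
    rw [h2, div_mul_eq_mul_div, le_div_iff₀ (by positivity), mul_comm]
    exact h1.trans hzz

theorem IsThinSVD.residual_le_of_le_projection (hX : IsThinSVD X U σ V) (hd : 0 < d)
    (hrank : 0 < sigmaMin hd σ) {y : Fin n → ℝ} {β : Fin d → ℝ}
    (hβ : IsLeastSquaresSolution X y β) {γ : ℝ} (hγ : 0 < γ)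
    (h : γ * l2norm y ≤ l2norm ((U * Uᵀ) *ᵥ y)) :
    l2norm (y - X *ᵥ β) ^ 2 ≤ sigmaMax hd σ ^ 2 * ((γ ^ 2)⁻¹ - 1) * l2norm β ^ 2 := by
  set r := y - X *ᵥ β with hr
  have hproj : (U * Uᵀ) *ᵥ y = X *ᵥ β := by
    have hy : y = r + X *ᵥ β := by rw [hr, sub_add_cancel]
    have hUr : Uᵀ *ᵥ r = 0 := by
      ext j
      have := congrFun (hX.sum_residual_smul hd hrank hβ) j
      rw [Finset.sum_apply] at this
      rw [← this]
      change ∑ i, U i j * r i = ∑ i, r i * U i j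
      exact Finset.sum_congr rfl fun i _ => mul_comm (U i j) (r i)
    rw [hy, Matrix.mulVec_add, ← Matrix.mulVec_mulVec, hUr, Matrix.mulVec_zero, zero_add,
      hX.mulVec_eq, Matrix.mulVec_mulVec, Matrix.mul_assoc, hX.orthonormal_left, Matrix.mul_one]
  have horth : r ⬝ᵥ (X *ᵥ β) = 0 := hβ.dotProduct_mulVec_eq_zero β
  have hpyth : y ⬝ᵥ y = r ⬝ᵥ r + (X *ᵥ β) ⬝ᵥ (X *ᵥ β) := by
    have hy : y = r + X *ᵥ β := by rw [hr, sub_add_cancel]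
    conv_lhs => rw [hy]
    rw [add_dotProduct, dotProduct_add, dotProduct_add, horth, dotProduct_comm (X *ᵥ β) r, horth]
    ring
  have hr0 : 0 ≤ r ⬝ᵥ r := Finset.sum_nonneg fun _ _ => mul_self_nonneg _
  have hb0 : 0 ≤ (X *ᵥ β) ⬝ᵥ (X *ᵥ β) := Finset.sum_nonneg fun _ _ => mul_self_nonneg _
  have hsq : γ ^ 2 * (y ⬝ᵥ y) ≤ (X *ᵥ β) ⬝ᵥ (X *ᵥ β) := by
    rw [hproj] at h
    have hy0 : 0 ≤ l2norm y := norm_nonneg _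
    have := pow_le_pow_left₀ (mul_nonneg hγ.le hy0) h 2
    rwa [mul_pow, l2norm_sq, l2norm_sq] at this
  have hγ2 : 0 < γ ^ 2 := by positivity
  have hy : y ⬝ᵥ y ≤ (γ ^ 2)⁻¹ * ((X *ᵥ β) ⬝ᵥ (X *ᵥ β)) := by
    rwa [inv_mul_eq_div, le_div_iff₀ hγ2, mul_comm]
  rw [l2norm_sq, l2norm_sq]
  have hmain : r ⬝ᵥ r ≤ ((γ ^ 2)⁻¹ - 1) * ((X *ᵥ β) ⬝ᵥ (X *ᵥ β)) := by linarith
  rcases le_or_gt 0 ((γ ^ 2)⁻¹ - 1) with h1 | h1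
  · have := mul_le_mul_of_nonneg_left (hX.le_sigmaMax_sq_mul hd β) h1
    linarith
  -- Here γ > 1, which forces Xβ = 0 and hence β = 0.
  · have hXβ : (X *ᵥ β) ⬝ᵥ (X *ᵥ β) = 0 := by nlinarith
    have hββ : β ⬝ᵥ β = 0 := by
      have := hX.sigmaMin_sq_mul_le hd hrank β
      rw [hXβ] at this
      have h2 : 0 ≤ β ⬝ᵥ β := Finset.sum_nonneg fun _ _ => mul_self_nonneg _
      have h3 : 0 < sigmaMin hd σ ^ 2 := by positivity
      nlinarith
    rw [hββ, mul_zero]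
    rw [hXβ, mul_zero] at hmain
    exact hmain

end LeastSquares

/-! ### Union bound over the two events, and the bound in terms of γ. -/

theorem theorem2 {n d c : ℕ} (hd : 0 < d) (hcn : c ≤ n)
    (X : Matrix (Fin n) (Fin d) ℝ) (y : Fin n → ℝ)
    (U : Matrix (Fin n) (Fin d) ℝ) (σ : Fin d → ℝ) (V : Matrix (Fin d) (Fin d) ℝ)
    (hX : IsThinSVD X U σ V) (hrank : 0 < sigmaMin hd σ)
    (hc : 1000 * rowCoherence U * (d : ℝ) * (Real.log (d : ℝ) + 7) ≤ (c : ℝ))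
    (βlsr : Fin d → ℝ) (hlsr : IsLeastSquaresSolution X y βlsr) :
    (0.05 : ℝ) ≤ samplingProb {e : Fin c ↪ Fin n |
      ∀ βS : Fin d → ℝ,
        IsLeastSquaresSolution (samplingMatrix e * X) (samplingMatrix e *ᵥ y) βS →
          l2norm (y - X *ᵥ βS) ^ 2 ≤ 2.2 * l2norm (y - X *ᵥ βlsr) ^ 2 ∧
          l2norm (βlsr - βS) ^ 2 ≤
            1.2 / sigmaMin hd σ ^ 2 * l2norm (y - X *ᵥ βlsr) ^ 2} ∧
    ∀ γ : ℝ, 0 < γ → γ * l2norm y ≤ l2norm ((U * Uᵀ) *ᵥ y) →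
      1.2 / sigmaMin hd σ ^ 2 * l2norm (y - X *ᵥ βlsr) ^ 2 ≤
        1.2 * conditionNumber hd σ ^ 2 * ((γ ^ 2)⁻¹ - 1) * l2norm βlsr ^ 2 := by
  refine ⟨?_, fun γ hγ h => ?_⟩
  · set M := ⨆ i, leverageScore U i with hMdef
    have hd0 : (0 : ℝ) < d := by exact_mod_cast hd
    have hM : ∀ i, U i ⬝ᵥ U i ≤ M := fun i => by
      have := le_ciSup (Set.finite_range (leverageScore U)).bddAbove i
      rwa [leverageScore, l2norm_sq] at this
    have hnM : (d : ℝ) ≤ n * M := le_mul_of_dotProduct_self_rows_le hX.orthonormal_left hM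
    have hlog : 0 ≤ Real.log d := Real.log_nonneg (by exact_mod_cast hd)
    have hc' : 1000 * (n * M) * (Real.log d + 7) ≤ c := by
      have e : 1000 * rowCoherence U * (d : ℝ) = 1000 * (n * M) := by
        rw [rowCoherence, ← hMdef]; field_simp
      rwa [e] at hc
    have hc7 : 7000 * (n * M) ≤ c := by nlinarith
    have hc0 : (0 : ℝ) < c := by linarith
    have hn0 : (0 : ℝ) < n := hc0.trans_le (by exact_mod_cast hcn)
    have h1 := samplingProb_quadForm_rowGram_lt_le hd hcn hX.orthonormal_left hM hc'
    have h2 := samplingProb_dotProduct_sum_self_gt_le hd hcn hX.orthonormal_left hM hc7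
      (hX.sum_residual_smul hd hrank hlsr)
    refine le_trans ?_ (samplingProb_mono (E := {e : Fin c ↪ Fin n |
      (∀ x : Fin d → ℝ, (c : ℝ) / n / 40 * (x ⬝ᵥ x) ≤
        x ⬝ᵥ (rowGram U (Finset.univ.map e) *ᵥ x)) ∧
      (∑ i ∈ Finset.univ.map e, (y - X *ᵥ βlsr) i • U i) ⬝ᵥ
        (∑ i ∈ Finset.univ.map e, (y - X *ᵥ βlsr) i • U i) ≤
          1.2 * (((c : ℝ) / n / 40) ^ 2 * ((y - X *ᵥ βlsr) ⬝ᵥ (y - X *ᵥ βlsr)))})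
      fun e he βS hβS => ?_)
    · have := samplingProb_le_of_subset_union hcn (E := {e : Fin c ↪ Fin n |
        (∀ x : Fin d → ℝ, (c : ℝ) / n / 40 * (x ⬝ᵥ x) ≤
          x ⬝ᵥ (rowGram U (Finset.univ.map e) *ᵥ x)) ∧
        (∑ i ∈ Finset.univ.map e, (y - X *ᵥ βlsr) i • U i) ⬝ᵥ
          (∑ i ∈ Finset.univ.map e, (y - X *ᵥ βlsr) i • U i) ≤
            1.2 * (((c : ℝ) / n / 40) ^ 2 * ((y - X *ᵥ βlsr) ⬝ᵥ (y - X *ᵥ βlsr)))})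
        (E₁ := {e : Fin c ↪ Fin n | ¬ ∀ x : Fin d → ℝ, (c : ℝ) / n / 40 * (x ⬝ᵥ x) ≤
          x ⬝ᵥ (rowGram U (Finset.univ.map e) *ᵥ x)})
        (E₂ := {e : Fin c ↪ Fin n |
          1.2 * (((c : ℝ) / n / 40) ^ 2 * ((y - X *ᵥ βlsr) ⬝ᵥ (y - X *ᵥ βlsr))) <
          (∑ i ∈ Finset.univ.map e, (y - X *ᵥ βlsr) i • U i) ⬝ᵥ
            (∑ i ∈ Finset.univ.map e, (y - X *ᵥ βlsr) i • U i)})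
        (fun e he => (not_and_or.1 he).imp id not_le.1)
      linarith
    · have := hX.sampled_solution_bounds hd hrank hlsr (by positivity) he.1 he.2 hβS
      convert this using 3
      norm_num
  · have h1 := hX.residual_le_of_le_projection hd hrank hlsr hγ h
    have h2 := mul_le_mul_of_nonneg_left h1
      (by positivity : 0 ≤ 1.2 / sigmaMin hd σ ^ 2)
    refine h2.trans (le_of_eq ?_)
    rw [conditionNumber]
    ring
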